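/- Let $x_1,\dots,x_4$ and $y_1,\dots,y_4$ be labeled points of the complex projective plane $\mathbb{P}^2$ in general position, i.e. no three of the $x_i$ are collinear and no three of the $y_i$ are collinear. Let $E_4\subset\mathbb{P}^2\times\mathbb{P}^2$ be their camera centers variety, i.e. the set of all $(a,b)$ for which there is a nonzero complex $3\times 3$ matrix $F$ with $Fa=0$, $F^{\top}b=0$ and $y_i^{\top}Fx_i=0$ for $i=1,\dots,4$. Let $\pi_x,\pi_y$ be the projections of $E_4$ to the first and the second factor. Then $E_4$ is a hypersurface in $\mathbb{P}^2\times\mathbb{P}^2$ (it is the zero locus of a nonconstant bihomogeneous polynomial that generates its vanishing ideal). Furthermore: 1. If both point sets are in standard position, i.e. $x_i\sim y_i\sim e_i$ for $i=1,\dots,4$, where $e_1,e_2,e_3$ are the standard basis vectors and $e_4=e_1+e_2+e_3$, then the equation of $E_4$ is $a^{\top}[a\odot b]_{\times}b=0$ (this polynomial cuts out $E_4$ and generates its vanishing ideal). Here $\odot$ is the entrywise product and $[v]_\times$ is the matrix of $w\mapsto v\times w$. 2. $\pi_x(E_4)=\pi_y(E_4)=\mathbb{P}^2$. 3. $E_4$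 has bidegree $(2,2)$: its vanishing ideal is generated by a bihomogeneous polynomial of bidegree $(2,2)$, and its multidegrees are $d_{(2,1)}(E_4)=d_{(1,2)}(E_4)=2$, where $d_{(i,j)}$ is the number of points of $E_4$ that lie on $i$ generic lines of the first plane and $j$ generic lines of the second. 4. For every $a\in\mathbb{P}^2\setminus\{x_1,\dots,x_4\}$ the fiber $\pi_x^{-1}(a)$ projects onto a conic in the second plane (the zero locus of a quadratic form of rank at least $2$), which is nondegenerate if $a$ lies on no line through two of the $x_i$. Likewise, for every $b\in\mathbb{P}^2\setminus\{y_1,\dots,y_4\}$ the fiber $\pi_y^{-1}(b)$ projects onto a conic in the first plane, which is nondegenerate if $b$ lies on no line through two of the $y_i$. -/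

import Mathlib

namespace CameraCenters

open Matrix MvPolynomial
open scoped LinearAlgebra.Projectivization

/-- The complex projective plane. -/
abbrev P2 : Type := ℙ ℂ (Fin 3 → ℂ)

/-- The projective space of nonzero complex `3 × 3` matrices up to scale. -/
abbrev P8 : Type := ℙ ℂ (Matrix (Fin 3) (Fin 3) ℂ)

/-! All conditions below that are written with the representatives `p.rep` of projective points
are homogeneous in each of them, hence do not depend on the choice of the representatives. -/

/-- The variety of all `(F, a, b)` with `F a = 0`, `Fᵀ b = 0` and `yᵢᵀ F xᵢ = 0` for all `i`. -/
def fundamentalEpipoles {n : ℕ} (x y : Fin n → P2) : Set (P8 × P2 × P2) :=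
  {t | t.1.rep *ᵥ t.2.1.rep = 0 ∧ t.1.repᵀ *ᵥ t.2.2.rep = 0 ∧
    ∀ i, (y i).rep ⬝ᵥ (t.1.rep *ᵥ (x i).rep) = 0}

/-- The camera centers variety of two labeled point sets: the image of `fundamentalEpipoles x y`
under the projection that forgets `F`. -/
def cameraCenters {n : ℕ} (x y : Fin n → P2) : Set (P2 × P2) :=
  Prod.snd '' fundamentalEpipoles x y

/-- No three of the labeled points lie on a line (in particular any two are distinct
when there are at least three of them). -/
def GeneralPosition {n : ℕ} (x : Fin n → P2) : Prop :=
  ∀ s : Fin 3 ↪ Fin n, Projectivization.Independent (x ∘ s)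

/-- The vectors `e₁, e₂, e₃, e₄ = e₁ + e₂ + e₃`. -/
def frameVec : Fin 4 → Fin 3 → ℂ :=
  ![![1, 0, 0], ![0, 1, 0], ![0, 0, 1], ![1, 1, 1]]

theorem frameVec_ne_zero (i : Fin 4) : frameVec i ≠ 0 := by
  intro h
  have h0 := congrFun h 0
  have h1 := congrFun h 1
  have h2 := congrFun h 2
  fin_cases i <;> simp [frameVec] at h0 h1 h2

/-- Four labeled points are in standard position if the `i`-th one is represented by `eᵢ`. -/
def StandardPosition (x : Fin 4 → P2) : Prop :=
  ∀ i, x i = Projectivization.mk ℂ (frameVec i) (frameVec_ne_zero i)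

/-- The matrix `[v]_×` of the linear map `w ↦ v × w`. -/
def crossMatrix {R : Type*} [CommRing R] (v : Fin 3 → R) : Matrix (Fin 3) (Fin 3) R :=
  !![0, -v 2, v 1;
     v 2, 0, -v 0;
     -v 1, v 0, 0]

/-- The coordinate ring of `P2 × P2`: the variables `inl i` are the coordinates of the first
factor, the variables `inr i` those of the second. -/
abbrev BiPoly : Type := MvPolynomial (Fin 3 ⊕ Fin 3) ℂ

/-- The polynomial `aᵀ [a ⊙ b]_× b`; the product `a * b` of vectors is the entrywise one. -/
noncomputable def standardEquation : BiPoly :=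
  let a : Fin 3 → BiPoly := fun i => X (Sum.inl i)
  let b : Fin 3 → BiPoly := fun i => X (Sum.inr i)
  a ⬝ᵥ (crossMatrix (a * b) *ᵥ b)

/-- `f` is bihomogeneous of degree `d` in the first and degree `e` in the second three variables. -/
def IsBihomogeneous (f : BiPoly) (d e : ℕ) : Prop :=
  IsWeightedHomogeneous (Sum.elim (fun _ => ((1, 0) : ℕ × ℕ)) (fun _ => ((0, 1) : ℕ × ℕ))) f (d, e)

/-- The zero locus in `P2 × P2` of a bihomogeneous polynomial. -/
def biZeroLocus (f : BiPoly) : Set (P2 × P2) :=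
  {p | eval (Sum.elim p.1.rep p.2.rep) f = 0}

/-- All pairs of nonzero vectors that represent a point of `E`. -/
def biCone (E : Set (P2 × P2)) : Set (Fin 3 ⊕ Fin 3 → ℂ) :=
  {w | ∃ (u v : Fin 3 → ℂ) (hu : u ≠ 0) (hv : v ≠ 0),
    (Projectivization.mk ℂ u hu, Projectivization.mk ℂ v hv) ∈ E ∧ w = Sum.elim u v}

/-- `f` is the equation of `E` (as a reduced variety): `E` is the zero locus of `f`, and `f`
generates the ideal of all polynomials that vanish on `E`. -/
def IsEquationOf (f : BiPoly) (E : Set (P2 × P2)) : Prop :=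
  E = biZeroLocus f ∧ vanishingIdeal ℂ (biCone E) = Ideal.span {f}

/-- `E` is a hypersurface of bidegree `(d, e)`. -/
def IsHypersurfaceOfBidegree (E : Set (P2 × P2)) (d e : ℕ) : Prop :=
  ∃ f : BiPoly, f ≠ 0 ∧ IsBihomogeneous f d e ∧ IsEquationOf f E

/-- `E` is a hypersurface: it is given by one nonzero bihomogeneous polynomial that is
not constant. -/
def IsHypersurface (E : Set (P2 × P2)) : Prop :=
  ∃ d e : ℕ, (d, e) ≠ (0, 0) ∧ IsHypersurfaceOfBidegree E d e

/-- The points of `E` on the lines `u k` of the first plane and the lines `v l` of the second;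
a line is given by the coefficients of a linear form. -/
def slice (E : Set (P2 × P2)) {i j : ℕ} (u : Fin i → Fin 3 → ℂ) (v : Fin j → Fin 3 → ℂ) :
    Set (P2 × P2) :=
  {p | p ∈ E ∧ (∀ k, u k ⬝ᵥ p.1.rep = 0) ∧ ∀ l, v l ⬝ᵥ p.2.rep = 0}

/-- The multidegree `d_(i,j)` of `E` is `m`: the number of points of `E` on `i` generic lines of
the first plane and `j` generic lines of the second is `m`. Generic means that the coefficients
of the lines lie in a nonempty Zariski open set, which may be taken to be the complement of the
zero locus of a nonzero polynomial `G`. -/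
def HasMultidegree (E : Set (P2 × P2)) (i j m : ℕ) : Prop :=
  ∃ G : MvPolynomial ((Fin i × Fin 3) ⊕ (Fin j × Fin 3)) ℂ, G ≠ 0 ∧
    ∀ (u : Fin i → Fin 3 → ℂ) (v : Fin j → Fin 3 → ℂ),
      eval (Sum.elim (fun t => u t.1 t.2) (fun t => v t.1 t.2)) G ≠ 0 →
        (slice E u v).encard = m

/-- The zero locus in the plane of the quadratic form of a matrix. -/
def quadric (M : Matrix (Fin 3) (Fin 3) ℂ) : Set P2 :=
  {p | p.rep ⬝ᵥ (M *ᵥ p.rep) = 0}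

/-- A (reduced) plane conic: the zero locus of a quadratic form of rank at least two, that is,
a nondegenerate conic or a union of two distinct lines. -/
def IsConic (C : Set P2) : Prop :=
  ∃ M : Matrix (Fin 3) (Fin 3) ℂ, M.IsSymm ∧ 2 ≤ M.rank ∧ C = quadric M

/-- A nondegenerate plane conic. -/
def IsNondegenerateConic (C : Set P2) : Prop :=
  ∃ M : Matrix (Fin 3) (Fin 3) ℂ, M.IsSymm ∧ M.det ≠ 0 ∧ C = quadric M

/-- The point `p` lies on no line through two of the labeled points. -/
def OffLines {n : ℕ} (x : Fin n → P2) (p : P2) : Prop :=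
  ∀ i j, i ≠ j → Projectivization.Independent ![x i, x j, p]

/-- The projection to the second plane of the fiber of `E` over `a` in the first. -/
def fiberOverFst (E : Set (P2 × P2)) (a : P2) : Set P2 :=
  Prod.snd '' (E ∩ Prod.fst ⁻¹' {a})

/-- The projection to the first plane of the fiber of `E` over `b` in the second. -/
def fiberOverSnd (E : Set (P2 × P2)) (b : P2) : Set P2 :=
  Prod.fst '' (E ∩ Prod.snd ⁻¹' {b})

end CameraCenters

namespace CameraCenters

open Matrix MvPolynomial
open scoped LinearAlgebra.Projectivization

/-! Linear changes of coordinates in the two planes bring both quadruples to the standard frame, and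
`F` is transported along (`mem_cameraCenters_iff_tripleForm`). There the frame constraints say that
the diagonal of `F` vanishes and its off-diagonal entries sum to zero. For generic `(a, b)` the
kernel conditions determine these six entries up to scale by explicit monomials, whose sum is
`-tripleForm a b`. Hence a nonzero `F` exists exactly when the triple form vanishes; degenerate
pairs need separate solutions (`exists_isFrameEpipolar_iff`).

The form is a prime polynomial (`prime_standardEquation`), so the Nullstellensatz makes it generate
the vanishing ideal (`standardEquation_dvd`), and bidegree `(2, 2)` is visible from its shape.

For fixed `a` it is a quadratic form in `b` whose matrix `fiberMatrix a` has zero diagonal and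
off-diagonal entries that are products of equations of opposite sides of the frame's quadrangle. All
of these vanish only at the four points, and the determinant is twice their product; this gives the
statements on conics.

Two generic lines in the first plane fix `a`, and a generic line in the second meets the resulting
conic in two points (`encard_line_inter_quadric`), which gives one multidegree. Everything about the
second projection follows by transposing `F`. -/

/-- The value of `aᵀ [a ⊙ b]_× b`. -/
def tripleForm {R : Type*} [CommRing R] (a b : Fin 3 → R) : R :=
  a ⬝ᵥ (crossMatrix (a * b) *ᵥ b)

theorem tripleForm_eq {R : Type*} [CommRing R] (a b : Fin 3 → R) :
    tripleForm a b = a 0 * a 1 * (b 2 * (b 1 - b 0)) + a 0 * a 2 * (b 1 * (b 0 - b 2)) +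
      a 1 * a 2 * (b 0 * (b 2 - b 1)) := by
  simp [tripleForm, crossMatrix, dotProduct, mulVec, Fin.sum_univ_three]
  ring

theorem tripleForm_self {R : Type*} [CommRing R] (a : Fin 3 → R) : tripleForm a a = 0 := by
  rw [tripleForm_eq]; ring

theorem tripleForm_smul_smul {R : Type*} [CommRing R] (s t : R) (a b : Fin 3 → R) :
    tripleForm (s • a) (t • b) = s ^ 2 * t ^ 2 * tripleForm a b := by
  simp only [tripleForm_eq, Pi.smul_apply, smul_eq_mul]; ring

theorem map_tripleForm {R S : Type*} [CommRing R] [CommRing S] (φ : R →+* S) (a b : Fin 3 → R) :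
    φ (tripleForm a b) = tripleForm (fun i => φ (a i)) (fun i => φ (b i)) := by
  simp [tripleForm_eq]

theorem eval_standardEquation (a b : Fin 3 → ℂ) :
    eval (Sum.elim a b) standardEquation = tripleForm a b := by
  change eval (Sum.elim a b) (tripleForm (fun i => X (Sum.inl i)) (fun i => X (Sum.inr i))) = _
  rw [map_tripleForm]
  simp

/-! ### Epipolar matrices of the standard frame. -/

/-- `F` has kernel vectors `a` on the right and `b` on the left and satisfies the four epipolar
constraints of the standard frame. -/
def IsFrameEpipolar (F : Matrix (Fin 3) (Fin 3) ℂ) (a b : Fin 3 → ℂ) : Prop :=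
  F *ᵥ a = 0 ∧ Fᵀ *ᵥ b = 0 ∧ ∀ i, frameVec i ⬝ᵥ (F *ᵥ frameVec i) = 0

theorem isFrameEpipolar_iff (F : Matrix (Fin 3) (Fin 3) ℂ) (a b : Fin 3 → ℂ) :
    IsFrameEpipolar F a b ↔
      (F 0 0 = 0 ∧ F 1 1 = 0 ∧ F 2 2 = 0) ∧
      F 0 1 + F 0 2 + F 1 0 + F 1 2 + F 2 0 + F 2 1 = 0 ∧
      (F 0 1 * a 1 + F 0 2 * a 2 = 0 ∧ F 1 0 * a 0 + F 1 2 * a 2 = 0 ∧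
        F 2 0 * a 0 + F 2 1 * a 1 = 0) ∧
      (F 1 0 * b 1 + F 2 0 * b 2 = 0 ∧ F 0 1 * b 0 + F 2 1 * b 2 = 0 ∧
        F 0 2 * b 0 + F 1 2 * b 1 = 0) := by
  unfold IsFrameEpipolar
  simp only [funext_iff, Fin.forall_fin_succ, mulVec, dotProduct, Fin.sum_univ_three,
    frameVec, transpose_apply, Pi.zero_apply]
  simp
  constructor
  · rintro ⟨⟨h1, h2, h3⟩, ⟨h4, h5, h6⟩, h7, h8, h9, h10⟩
    simp only [h7, h8, h9, zero_mul, zero_add, add_zero] at *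
    refine ⟨⟨trivial, trivial, trivial⟩, ?_, ⟨h1, h2, h3⟩, h4, h5, h6⟩
    linear_combination h10
  · rintro ⟨⟨h7, h8, h9⟩, h10, ⟨h1, h2, h3⟩, h4, h5, h6⟩
    simp only [h7, h8, h9, zero_mul, zero_add, add_zero]
    refine ⟨⟨h1, h2, h3⟩, ⟨h4, h5, h6⟩, trivial, trivial, trivial, ?_⟩
    linear_combination h10

/-- Each off-diagonal entry times the triple form is a combination of the linear equations on `F`.
One such identity suffices: permuting the three coordinates changes the form only by the sign of the
permutation and moves `F 0 1` to any other off-diagonal entry. -/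
theorem IsFrameEpipolar.tripleForm_eq_zero {F : Matrix (Fin 3) (Fin 3) ℂ} {a b : Fin 3 → ℂ}
    (h : IsFrameEpipolar F a b) (hF : F ≠ 0) : tripleForm a b = 0 := by
  rw [isFrameEpipolar_iff] at h
  obtain ⟨⟨d0, d1, d2⟩, s, ⟨h1, h2, h3⟩, h4, h5, h6⟩ := h
  -- The last kernel equation is not needed: the six are tied by the relation `b ⬝ᵥ (F *ᵥ a) = a ⬝ᵥ
  -- (Fᵀ *ᵥ b)`.
  have key : ∀ {a₀ a₁ a₂ b₀ b₁ b₂ f₀₁ f₀₂ f₁₀ f₁₂ f₂₀ f₂₁ : ℂ},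
      f₀₁ + f₀₂ + f₁₀ + f₁₂ + f₂₀ + f₂₁ = 0 →
      f₀₁ * a₁ + f₀₂ * a₂ = 0 → f₁₀ * a₀ + f₁₂ * a₂ = 0 → f₂₀ * a₀ + f₂₁ * a₁ = 0 →
      f₁₀ * b₁ + f₂₀ * b₂ = 0 → f₀₁ * b₀ + f₂₁ * b₂ = 0 →
      f₀₁ * (a₀ * a₁ * (b₂ * (b₁ - b₀)) + a₀ * a₂ * (b₁ * (b₀ - b₂)) +
        a₁ * a₂ * (b₀ * (b₂ - b₁))) = 0 := by
    intro a₀ a₁ a₂ b₀ b₁ b₂ f₀₁ f₀₂ f₁₀ f₁₂ f₂₀ f₂₁ s h1 h2 h3 h4 h5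
    linear_combination (-(a₀ * b₁ * a₂ * b₂)) * s + a₀ * b₁ * b₂ * h1 + a₀ * b₁ * a₂ * h5 +
      a₀ * b₁ * a₂ * h4 + a₀ * b₁ * b₂ * h2 +
      (a₂ * b₂ - b₁ * a₂ - a₀ * b₂) * (a₀ * h4 - b₂ * h3 + a₁ * h5)
  by_contra hg
  rw [tripleForm_eq] at hg
  have h01 : F 0 1 = 0 := by
    refine (mul_eq_zero.1 (key s h1 h2 h3 h4 h5)).resolve_right hg
  have h02 : F 0 2 = 0 := by
    refine (mul_eq_zero.1 (key (a₀ := a 0) (a₁ := a 2) (a₂ := a 1) (b₀ := b 0) (b₁ := b 2)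
      (b₂ := b 1) (f₀₁ := F 0 2) (f₀₂ := F 0 1) (f₁₀ := F 2 0) (f₁₂ := F 2 1) (f₂₀ := F 1 0)
      (f₂₁ := F 1 2) ?_ ?_ ?_ ?_ ?_ ?_)).resolve_right fun h => hg ?_
    · linear_combination s
    · linear_combination h1
    · linear_combination h3
    · linear_combination h2
    · linear_combination h4
    · linear_combination h6
    · linear_combination -h
  have h10 : F 1 0 = 0 := by
    refine (mul_eq_zero.1 (key (a₀ := a 1) (a₁ := a 0) (a₂ := a 2) (b₀ := b 1) (b₁ := b 0)
      (b₂ := b 2) (f₀₁ := F 1 0) (f₀₂ := F 1 2) (f₁₀ := F 0 1) (f₁₂ := F 0 2) (f₂₀ := F 2 1)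
      (f₂₁ := F 2 0) ?_ ?_ ?_ ?_ ?_ ?_)).resolve_right fun h => hg ?_
    · linear_combination s
    · linear_combination h2
    · linear_combination h1
    · linear_combination h3
    · linear_combination h5
    · linear_combination h4
    · linear_combination -h
  have h12 : F 1 2 = 0 := by
    refine (mul_eq_zero.1 (key (a₀ := a 1) (a₁ := a 2) (a₂ := a 0) (b₀ := b 1) (b₁ := b 2)
      (b₂ := b 0) (f₀₁ := F 1 2) (f₀₂ := F 1 0) (f₁₀ := F 2 1) (f₁₂ := F 2 0) (f₂₀ := F 0 1)
      (f₂₁ := F 0 2) ?_ ?_ ?_ ?_ ?_ ?_)).resolve_right fun h => hg ?_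
    · linear_combination s
    · linear_combination h2
    · linear_combination h3
    · linear_combination h1
    · linear_combination h5
    · linear_combination h6
    · linear_combination h
  have h20 : F 2 0 = 0 := by
    refine (mul_eq_zero.1 (key (a₀ := a 2) (a₁ := a 0) (a₂ := a 1) (b₀ := b 2) (b₁ := b 0)
      (b₂ := b 1) (f₀₁ := F 2 0) (f₀₂ := F 2 1) (f₁₀ := F 0 2) (f₁₂ := F 0 1) (f₂₀ := F 1 2)
      (f₂₁ := F 1 0) ?_ ?_ ?_ ?_ ?_ ?_)).resolve_right fun h => hg ?_
    · linear_combination s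
    · linear_combination h3
    · linear_combination h1
    · linear_combination h2
    · linear_combination h6
    · linear_combination h4
    · linear_combination h
  have h21 : F 2 1 = 0 := by
    refine (mul_eq_zero.1 (key (a₀ := a 2) (a₁ := a 1) (a₂ := a 0) (b₀ := b 2) (b₁ := b 1)
      (b₂ := b 0) (f₀₁ := F 2 1) (f₀₂ := F 2 0) (f₁₀ := F 1 2) (f₁₂ := F 1 0) (f₂₀ := F 0 2)
      (f₂₁ := F 0 1) ?_ ?_ ?_ ?_ ?_ ?_)).resolve_right fun h => hg ?_
    · linear_combination s
    · linear_combination h3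
    · linear_combination h2
    · linear_combination h1
    · linear_combination h6
    · linear_combination h5
    · linear_combination -h
  apply hF
  ext i j
  fin_cases i <;> fin_cases j <;> assumption

/-- The linear system for the off-diagonal entries of a frame epipolar matrix has a nonzero
solution. -/
def HasEntries (a₀ a₁ a₂ b₀ b₁ b₂ : ℂ) : Prop :=
  ∃ f₀₁ f₀₂ f₁₀ f₁₂ f₂₀ f₂₁ : ℂ,
    (f₀₁ ≠ 0 ∨ f₀₂ ≠ 0 ∨ f₁₀ ≠ 0 ∨ f₁₂ ≠ 0 ∨ f₂₀ ≠ 0 ∨ f₂₁ ≠ 0) ∧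
    f₀₁ + f₀₂ + f₁₀ + f₁₂ + f₂₀ + f₂₁ = 0 ∧
    (f₀₁ * a₁ + f₀₂ * a₂ = 0 ∧ f₁₀ * a₀ + f₁₂ * a₂ = 0 ∧ f₂₀ * a₀ + f₂₁ * a₁ = 0) ∧
    f₁₀ * b₁ + f₂₀ * b₂ = 0 ∧ f₀₁ * b₀ + f₂₁ * b₂ = 0 ∧ f₀₂ * b₀ + f₁₂ * b₁ = 0

theorem HasEntries.exists_isFrameEpipolar {a b : Fin 3 → ℂ}
    (h : HasEntries (a 0) (a 1) (a 2) (b 0) (b 1) (b 2)) :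
    ∃ F : Matrix (Fin 3) (Fin 3) ℂ, F ≠ 0 ∧ IsFrameEpipolar F a b := by
  obtain ⟨f₀₁, f₀₂, f₁₀, f₁₂, f₂₀, f₂₁, hne, h⟩ := h
  refine ⟨!![0, f₀₁, f₀₂; f₁₀, 0, f₁₂; f₂₀, f₂₁, 0], ?_, ?_⟩
  · intro h0
    have e := fun i j => congrFun (congrFun h0 i) j
    have e01 := e 0 1
    have e02 := e 0 2
    have e10 := e 1 0
    have e12 := e 1 2
    have e20 := e 2 0
    have e21 := e 2 1
    simp at e01 e02 e10 e12 e20 e21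
    simp [e01, e02, e10, e12, e20, e21] at hne
  · rw [isFrameEpipolar_iff]
    exact ⟨⟨rfl, rfl, rfl⟩, h⟩

theorem HasEntries.transpose {a₀ a₁ a₂ b₀ b₁ b₂ : ℂ} (h : HasEntries a₀ a₁ a₂ b₀ b₁ b₂) :
    HasEntries b₀ b₁ b₂ a₀ a₁ a₂ := by
  obtain ⟨f₀₁, f₀₂, f₁₀, f₁₂, f₂₀, f₂₁, hne, s, ⟨h1, h2, h3⟩, h4, h5, h6⟩ := h
  exact ⟨f₁₀, f₂₀, f₀₁, f₂₁, f₀₂, f₁₂, by tauto, by linear_combination s,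
    ⟨h4, h5, h6⟩, h1, h2, h3⟩

/-- The cyclic symmetry of the coordinates; with `HasEntries.transpose` it reduces the degenerate
cases to two. -/
theorem HasEntries.rotate {a₀ a₁ a₂ b₀ b₁ b₂ : ℂ} (h : HasEntries a₀ a₁ a₂ b₀ b₁ b₂) :
    HasEntries a₂ a₀ a₁ b₂ b₀ b₁ := by
  obtain ⟨f₀₁, f₀₂, f₁₀, f₁₂, f₂₀, f₂₁, hne, s, ⟨h1, h2, h3⟩, h4, h5, h6⟩ := h
  exact ⟨f₂₀, f₂₁, f₀₂, f₀₁, f₁₂, f₁₀, by tauto, by linear_combination s,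
    ⟨h3, by linear_combination h1, by linear_combination h2⟩, by linear_combination h6,
    by linear_combination h4, by linear_combination h5⟩

theorem hasEntries_of_eq_zero_of_eq_zero (a₀ b₀ b₁ b₂ : ℂ) : HasEntries a₀ 0 0 b₀ b₁ b₂ := by
  by_cases hb : b₀ = 0
  · exact ⟨1, -1, 0, 0, 0, 0, by simp, by ring, ⟨by ring, by ring, by ring⟩, by ring,
      by rw [hb]; ring, by rw [hb]; ring⟩
  by_cases h : b₂ = b₀
  · exact ⟨b₂, 0, 0, 0, 0, -b₀, by simp [hb], by rw [h]; ring, ⟨by ring, by ring, by ring⟩,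
      by ring, by ring, by ring⟩
  -- With `f₁₀ = f₂₀ = 0`, the kernel equations are solved by `f₀₁ = λ b₂`, `f₂₁ = -λ b₀`, `f₀₂ = μ
  -- b₁`, `f₁₂ = -μ b₀`. The sum condition `λ (b₂ - b₀) + μ (b₁ - b₀) = 0` then dictates `λ` and
  -- `μ`.
  · have h' : b₀ - b₂ ≠ 0 := sub_ne_zero.2 (Ne.symm h)
    exact ⟨(b₁ - b₀) * b₂, (b₀ - b₂) * b₁, 0, -((b₀ - b₂) * b₀), 0, -((b₁ - b₀) * b₀),
      by simp [hb, h'], by ring, ⟨by ring, by ring, by ring⟩, by ring, by ring, by ring⟩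

theorem hasEntries_of_common_zero {a₀ b₀ a₂ b₂ : ℂ} (ha : a₀ ≠ 0 ∨ a₂ ≠ 0)
    (hb : b₀ ≠ 0 ∨ b₂ ≠ 0) : HasEntries a₀ 0 a₂ b₀ 0 b₂ := by
  by_cases h : a₂ = a₀
  · subst h
    have ha : a₂ ≠ 0 := by tauto
    exact ⟨0, 0, a₂, -a₂, 0, 0, by simp [ha], by ring, ⟨by ring, by ring, by ring⟩, by ring,
      by ring, by ring⟩
  -- With `f₀₂ = f₂₀ = 0`, take `(f₀₁, f₂₁) = λ (b₂, -b₀)` and `(f₁₀, f₁₂) = μ (a₂, -a₀)`; the sum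
  -- condition is `λ (b₂ - b₀) + μ (a₂ - a₀) = 0`.
  · have h' : a₀ - a₂ ≠ 0 := sub_ne_zero.2 (Ne.symm h)
    refine ⟨(a₀ - a₂) * b₂, 0, (b₂ - b₀) * a₂, -((b₂ - b₀) * a₀), 0, -((a₀ - a₂) * b₀),
      ?_, by ring, ⟨by ring, by ring, by ring⟩, by ring, by ring, by ring⟩
    rcases hb with hb | hb <;> simp [hb, h']

theorem exists_isFrameEpipolar {a b : Fin 3 → ℂ} (hab : tripleForm a b = 0) :
    ∃ F : Matrix (Fin 3) (Fin 3) ℂ, F ≠ 0 ∧ IsFrameEpipolar F a b := by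
  apply HasEntries.exists_isFrameEpipolar
  rw [tripleForm_eq] at hab
  generalize a 0 = a₀, a 1 = a₁, a 2 = a₂, b 0 = b₀, b 1 = b₁, b 2 = b₂ at *
  by_cases ha12 : a₁ = 0 ∧ a₂ = 0
  · rw [ha12.1, ha12.2]; exact hasEntries_of_eq_zero_of_eq_zero _ _ _ _
  by_cases ha02 : a₀ = 0 ∧ a₂ = 0
  · rw [ha02.1, ha02.2]; exact (hasEntries_of_eq_zero_of_eq_zero _ _ _ _).rotate
  by_cases ha01 : a₀ = 0 ∧ a₁ = 0
  · rw [ha01.1, ha01.2]; exact (hasEntries_of_eq_zero_of_eq_zero _ _ _ _).rotate.rotate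
  by_cases hb12 : b₁ = 0 ∧ b₂ = 0
  · rw [hb12.1, hb12.2]; exact (hasEntries_of_eq_zero_of_eq_zero _ _ _ _).transpose
  by_cases hb02 : b₀ = 0 ∧ b₂ = 0
  · rw [hb02.1, hb02.2]; exact (hasEntries_of_eq_zero_of_eq_zero _ _ _ _).rotate.transpose
  by_cases hb01 : b₀ = 0 ∧ b₁ = 0
  · rw [hb01.1, hb01.2]; exact (hasEntries_of_eq_zero_of_eq_zero _ _ _ _).rotate.rotate.transpose
  by_cases h1 : a₁ = 0 ∧ b₁ = 0
  · rw [h1.1, h1.2]; exact hasEntries_of_common_zero (by tauto) (by tauto)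
  by_cases h2 : a₂ = 0 ∧ b₂ = 0
  · rw [h2.1, h2.2]; exact (hasEntries_of_common_zero (by tauto) (by tauto)).rotate
  by_cases h0 : a₀ = 0 ∧ b₀ = 0
  · rw [h0.1, h0.2]; exact (hasEntries_of_common_zero (by tauto) (by tauto)).rotate.rotate
  -- These monomials satisfy the kernel equations identically, and their sum is minus the triple
  -- form. They vanish simultaneously only in the degenerate cases excluded above.
  refine ⟨a₀ * a₂ * b₁ * b₂, -(a₀ * a₁ * b₁ * b₂), -(a₁ * a₂ * b₀ * b₂), a₁ * a₀ * b₀ * b₂,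
    a₂ * a₁ * b₀ * b₁, -(a₂ * a₀ * b₀ * b₁), ?_, by linear_combination -hab,
    ⟨by ring, by ring, by ring⟩, by ring, by ring, by ring⟩
  clear hab
  by_cases ha₀ : a₀ = 0
  · by_cases hb₁ : b₁ = 0 <;> simp_all
  by_cases ha₁ : a₁ = 0
  · by_cases hb₀ : b₀ = 0 <;> simp_all
  by_cases ha₂ : a₂ = 0
  · by_cases hb₀ : b₀ = 0 <;> simp_all
  by_cases hb₀ : b₀ = 0 <;> by_cases hb₁ : b₁ = 0 <;> simp_all

theorem exists_isFrameEpipolar_iff {a b : Fin 3 → ℂ} :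
    (∃ F : Matrix (Fin 3) (Fin 3) ℂ, F ≠ 0 ∧ IsFrameEpipolar F a b) ↔ tripleForm a b = 0 :=
  ⟨fun ⟨_, hF, h⟩ => h.tripleForm_eq_zero hF, exists_isFrameEpipolar⟩

/-! ### Primality of the standard equation and its vanishing ideal. -/

theorem standardEquation_eq : standardEquation =
    (X (Sum.inl 1) * (X (Sum.inr 2) * (X (Sum.inr 1) - X (Sum.inr 0))) +
      X (Sum.inl 2) * (X (Sum.inr 1) * (X (Sum.inr 0) - X (Sum.inr 2)))) * X (Sum.inl 0) +
    X (Sum.inl 1) * (X (Sum.inl 2) * (X (Sum.inr 0) * (X (Sum.inr 2) - X (Sum.inr 1)))) := by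
  change tripleForm (fun i => X (Sum.inl i)) (fun i => X (Sum.inr i)) = _
  rw [tripleForm_eq]
  ring

theorem not_dvd_of_eval {σ : Type*} {p q : MvPolynomial σ ℂ} (w : σ → ℂ) (hp : eval w p = 0)
    (hq : eval w q ≠ 0) : ¬ p ∣ q := by
  rintro ⟨r, rfl⟩
  simp [hp] at hq

theorem notMem_vars_of_mem_supported {σ : Type*} {p : MvPolynomial σ ℂ} {s : Set σ} {i : σ}
    (hp : p ∈ supported ℂ s) (hi : i ∉ s) : i ∉ p.vars :=
  fun h => hi (mem_supported.1 hp h)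

theorem irreducible_X_sub_X {σ : Type*} {i j : σ} (hij : i ≠ j) :
    Irreducible (X i - X j : MvPolynomial σ ℂ) := by
  have h := irreducible_mul_X_add (1 : MvPolynomial σ ℂ) (-X j) i one_ne_zero (by simp)
    (by simpa [vars_neg, vars_X] using hij) isRelPrime_one_left
  rwa [one_mul, ← sub_eq_add_neg] at h

/-- The polynomial has degree one in the variable `inl 0`, so it is irreducible once its two
coefficients are coprime. The constant coefficient is a product of four irreducible linear forms;
for each, a point where it vanishes and the leading coefficient does not rules out a common factor.
-/
theorem prime_standardEquation : Prime standardEquation := by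
  rw [← UniqueFactorizationMonoid.irreducible_iff_prime, standardEquation_eq]
  have hX : ∀ {i : Fin 3 ⊕ Fin 3}, i ≠ Sum.inl 0 →
      (X i : BiPoly) ∈ supported ℂ {i | i ≠ Sum.inl 0} := fun h => X_mem_supported.2 h
  have h1 := hX (i := Sum.inl 1) (by simp)
  have h2 := hX (i := Sum.inl 2) (by simp)
  have k0 := hX (i := Sum.inr 0) (by simp)
  have k1 := hX (i := Sum.inr 1) (by simp)
  have k2 := hX (i := Sum.inr 2) (by simp)
  refine irreducible_mul_X_add _ _ _ ?_ ?_ ?_ ?_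
  · intro h
    have := congrArg (eval (Sum.elim ![0, 1, 0] ![0, 1, 1])) h
    simp at this
  · exact notMem_vars_of_mem_supported (s := {i | i ≠ Sum.inl 0})
      (add_mem (mul_mem h1 (mul_mem k2 (sub_mem k1 k0))) (mul_mem h2 (mul_mem k1 (sub_mem k0 k2))))
      (by simp)
  · exact notMem_vars_of_mem_supported (s := {i | i ≠ Sum.inl 0})
      (mul_mem h1 (mul_mem h2 (mul_mem k0 (sub_mem k2 k1)))) (by simp)
  · refine IsRelPrime.mul_right ?_ (IsRelPrime.mul_right ?_ (IsRelPrime.mul_right ?_ ?_))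
    · refine ((X_prime.irreducible.isRelPrime_iff_not_dvd).2
        (not_dvd_of_eval (Sum.elim ![0, 0, 1] ![1, 1, 0]) ?_ ?_)).symm <;> simp
    · refine ((X_prime.irreducible.isRelPrime_iff_not_dvd).2
        (not_dvd_of_eval (Sum.elim ![0, 1, 0] ![0, 1, 1]) ?_ ?_)).symm <;> simp
    · refine ((X_prime.irreducible.isRelPrime_iff_not_dvd).2
        (not_dvd_of_eval (Sum.elim ![0, 1, 0] ![0, 1, 1]) ?_ ?_)).symm <;> simp
    · refine (((irreducible_X_sub_X (by simp)).isRelPrime_iff_not_dvd).2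
        (not_dvd_of_eval (Sum.elim ![0, 1, 0] ![0, 1, 1]) ?_ ?_)).symm <;> simp

/-- A polynomial that vanishes at all zeros `(a, b)` of the standard equation with `a ≠ 0` and
`b ≠ 0` is a multiple of it. -/
theorem standardEquation_dvd {p : BiPoly}
    (hp : ∀ a b : Fin 3 → ℂ, a ≠ 0 → b ≠ 0 → tripleForm a b = 0 → eval (Sum.elim a b) p = 0) :
    standardEquation ∣ p := by
  have hprime : (Ideal.span {standardEquation}).IsPrime :=
    (Ideal.span_singleton_prime prime_standardEquation.ne_zero).2 prime_standardEquation
  -- The hypothesis says nothing when `a = 0` or `b = 0`. The extra factor vanishes there, so the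
  -- Nullstellensatz applies to the product; primality then removes the factor, since the equation
  -- vanishes at the all-ones point and a variable does not.
  have hmem : p * (X (Sum.inl 0) * X (Sum.inr 0)) ∈ Ideal.span {standardEquation} := by
    rw [← MvPolynomial.IsPrime.vanishingIdeal_zeroLocus (K := ℂ) (Ideal.span {standardEquation}),
      mem_vanishingIdeal_iff]
    intro w hw
    have hw0 : eval w standardEquation = 0 := by
      simpa [aeval_eq_eval] using hw _ (Ideal.mem_span_singleton_self _)
    obtain ⟨a, b, rfl⟩ : ∃ a b, w = Sum.elim a b := ⟨_, _, (Sum.elim_comp_inl_inr w).symm⟩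
    rw [eval_standardEquation] at hw0
    simp only [aeval_eq_eval, map_mul, eval_X, Sum.elim_inl, Sum.elim_inr]
    by_cases ha : a 0 = 0
    · simp [ha]
    by_cases hb : b 0 = 0
    · simp [hb]
    rw [hp a b (fun h => ha (by simp [h])) (fun h => hb (by simp [h])) hw0, zero_mul]
  rw [Ideal.mem_span_singleton] at hmem
  refine (prime_standardEquation.dvd_or_dvd hmem).resolve_right fun h => ?_
  obtain h | h := prime_standardEquation.dvd_or_dvd h
  · refine not_dvd_of_eval (Sum.elim 1 1) ?_ ?_ h
    · rw [eval_standardEquation, tripleForm_self]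
    · simp
  · refine not_dvd_of_eval (Sum.elim 1 1) ?_ ?_ h
    · rw [eval_standardEquation, tripleForm_self]
    · simp

/-! ### Linear coordinate changes. -/

/-- The linear forms given by the rows of `M`, in the variables `ι j`. -/
noncomputable def rowForms (ι : Fin 3 → Fin 3 ⊕ Fin 3) (M : Matrix (Fin 3) (Fin 3) ℂ) :
    Fin 3 → BiPoly :=
  fun i => ∑ j, C (M i j) * X (ι j)

/-- Linear substitution by `M` in the first and by `N` in the second group of variables. -/
noncomputable def linSubst (M N : Matrix (Fin 3) (Fin 3) ℂ) : BiPoly →ₐ[ℂ] BiPoly :=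
  bind₁ (Sum.elim (rowForms Sum.inl M) (rowForms Sum.inr N))

theorem eval_linSubst (M N : Matrix (Fin 3) (Fin 3) ℂ) (p : BiPoly) (a b : Fin 3 → ℂ) :
    eval (Sum.elim a b) (linSubst M N p) = eval (Sum.elim (M *ᵥ a) (N *ᵥ b)) p := by
  have h : (fun i => eval (Sum.elim a b) (Sum.elim (rowForms Sum.inl M) (rowForms Sum.inr N) i)) =
      Sum.elim (M *ᵥ a) (N *ᵥ b) := by
    funext i
    rcases i with i | i <;> simp [rowForms, mulVec, dotProduct]
  rw [linSubst, ← h]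
  exact eval₂Hom_bind₁ _ _ _ _

theorem linSubst_linSubst {M M' N N' : Matrix (Fin 3) (Fin 3) ℂ} (hM : M' * M = 1)
    (hN : N' * N = 1) (p : BiPoly) : linSubst M N (linSubst M' N' p) = p := by
  refine MvPolynomial.funext fun w => ?_
  obtain ⟨a, b, rfl⟩ : ∃ a b, w = Sum.elim a b := ⟨_, _, (Sum.elim_comp_inl_inr w).symm⟩
  rw [eval_linSubst, eval_linSubst, mulVec_mulVec, mulVec_mulVec, hM, hN, one_mulVec, one_mulVec]

theorem isBihomogeneous_linSubst_standardEquation (M N : Matrix (Fin 3) (Fin 3) ℂ) :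
    IsBihomogeneous (linSubst M N standardEquation) 2 2 := by
  have hf : linSubst M N standardEquation =
      tripleForm (rowForms Sum.inl M) (rowForms Sum.inr N) := by
    change linSubst M N (tripleForm (fun i => X (Sum.inl i)) (fun i => X (Sum.inr i))) = _
    have := map_tripleForm (linSubst M N).toRingHom (fun i => X (Sum.inl i))
      (fun i => X (Sum.inr i))
    simpa [linSubst] using this
  have ha : ∀ i, IsBihomogeneous (rowForms Sum.inl M i) 1 0 := fun i =>
    IsWeightedHomogeneous.sum _ _ _ fun j _ => (isWeightedHomogeneous_X _ _ _).C_mul _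
  have hb : ∀ i, IsBihomogeneous (rowForms Sum.inr N i) 0 1 := fun i =>
    IsWeightedHomogeneous.sum _ _ _ fun j _ => (isWeightedHomogeneous_X _ _ _).C_mul _
  have key : ∀ i j k l m, IsBihomogeneous (rowForms Sum.inl M i * rowForms Sum.inl M j *
      (rowForms Sum.inr N k * (rowForms Sum.inr N l - rowForms Sum.inr N m))) 2 2 :=
    fun i j k l m => ((ha i).mul (ha j)).mul ((hb k).mul ((hb l).sub (hb m)))
  rw [hf, tripleForm_eq]
  exact ((key _ _ _ _ _).add (key _ _ _ _ _)).add (key _ _ _ _ _)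

/-- The zero locus of a coordinate change of the standard equation has it as its equation. -/
theorem isEquationOf_linSubst {M N : Matrix (Fin 3) (Fin 3) ℂ} (hM : IsUnit M.det)
    (hN : IsUnit N.det) {E : Set (P2 × P2)}
    (hE : ∀ p : P2 × P2, p ∈ E ↔ tripleForm (M *ᵥ p.1.rep) (N *ᵥ p.2.rep) = 0) :
    IsEquationOf (linSubst M N standardEquation) E := by
  have hcone : ∀ (u v : Fin 3 → ℂ) (hu : u ≠ 0) (hv : v ≠ 0),
      (Projectivization.mk ℂ u hu, Projectivization.mk ℂ v hv) ∈ E ↔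
        tripleForm (M *ᵥ u) (N *ᵥ v) = 0 := by
    intro u v hu hv
    obtain ⟨s, hs⟩ := Projectivization.exists_smul_eq_mk_rep ℂ u hu
    obtain ⟨t, ht⟩ := Projectivization.exists_smul_eq_mk_rep ℂ v hv
    rw [hE, ← hs, ← ht]
    simp only [Units.smul_def, mulVec_smul, tripleForm_smul_smul]
    simp
  constructor
  · ext p
    rw [hE, biZeroLocus, Set.mem_ofPred_eq, eval_linSubst, eval_standardEquation]
  · ext p
    rw [mem_vanishingIdeal_iff, Ideal.mem_span_singleton]
    constructor
    · intro hp
      -- Divisibility is proved in standard coordinates and carried back by the inverse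
      -- substitution.
      have hdvd : standardEquation ∣ linSubst M⁻¹ N⁻¹ p := by
        refine standardEquation_dvd fun a b ha hb hab => ?_
        rw [eval_linSubst]
        have hu : M⁻¹ *ᵥ a ≠ 0 := by
          intro h
          apply ha
          rw [← one_mulVec a, ← mul_nonsing_inv M hM, ← mulVec_mulVec, h, mulVec_zero]
        have hv : N⁻¹ *ᵥ b ≠ 0 := by
          intro h
          apply hb
          rw [← one_mulVec b, ← mul_nonsing_inv N hN, ← mulVec_mulVec, h, mulVec_zero]
        have := hp (Sum.elim (M⁻¹ *ᵥ a) (N⁻¹ *ᵥ b)) ⟨_, _, hu, hv, ?_, rfl⟩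
        · simpa [aeval_eq_eval] using this
        · rw [hcone, mulVec_mulVec, mulVec_mulVec, mul_nonsing_inv M hM, mul_nonsing_inv N hN,
            one_mulVec, one_mulVec, hab]
      have := map_dvd (linSubst M N) hdvd
      rwa [linSubst_linSubst (nonsing_inv_mul M hM) (nonsing_inv_mul N hN)] at this
    · rintro ⟨q, rfl⟩ _ ⟨u, v, hu, hv, huv, rfl⟩
      rw [hcone] at huv
      simp [aeval_eq_eval, eval_linSubst, eval_standardEquation, huv]

/-! ### Transposition symmetry and normalization to the standard frame. -/

theorem mem_cameraCenters_iff {n : ℕ} {x y : Fin n → P2} {p : P2 × P2} :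
    p ∈ cameraCenters x y ↔ ∃ F : Matrix (Fin 3) (Fin 3) ℂ, F ≠ 0 ∧ F *ᵥ p.1.rep = 0 ∧
      Fᵀ *ᵥ p.2.rep = 0 ∧ ∀ i, (y i).rep ⬝ᵥ (F *ᵥ (x i).rep) = 0 := by
  constructor
  · rintro ⟨⟨F, q⟩, h, rfl⟩
    exact ⟨F.rep, F.rep_nonzero, h⟩
  · rintro ⟨F, hF, h1, h2, h3⟩
    obtain ⟨t, ht⟩ := Projectivization.exists_smul_eq_mk_rep ℂ F hF
    refine ⟨(Projectivization.mk ℂ F hF, p), ⟨?_, ?_, fun i => ?_⟩, rfl⟩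
    · simp only [← ht, Units.smul_def, smul_mulVec, h1, smul_zero]
    · simp only [← ht, Units.smul_def, transpose_smul, smul_mulVec, h2, smul_zero]
    · simp only [← ht, Units.smul_def, smul_mulVec, dotProduct_smul, h3, smul_zero]

theorem dotProduct_transpose_mulVec {R : Type*} [CommRing R] (F : Matrix (Fin 3) (Fin 3) R)
    (u v : Fin 3 → R) : u ⬝ᵥ (Fᵀ *ᵥ v) = v ⬝ᵥ (F *ᵥ u) := by
  rw [mulVec_transpose, dotProduct_comm, dotProduct_mulVec]

theorem mem_cameraCenters_swap {n : ℕ} {x y : Fin n → P2} {p : P2 × P2} :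
    p.swap ∈ cameraCenters y x ↔ p ∈ cameraCenters x y := by
  have key : ∀ {x y : Fin n → P2} {p : P2 × P2}, p ∈ cameraCenters x y →
      p.swap ∈ cameraCenters y x := by
    intro x y p h
    rw [mem_cameraCenters_iff] at h ⊢
    obtain ⟨F, hF, h1, h2, h3⟩ := h
    refine ⟨Fᵀ, by simpa using hF, h2, by simpa using h1, fun i => ?_⟩
    rw [dotProduct_transpose_mulVec]
    exact h3 i
  exact ⟨fun h => by simpa using key h, key⟩

/-- `M` is an invertible matrix that moves the labeled points to the standard frame. -/
structure IsNormalizing (M : Matrix (Fin 3) (Fin 3) ℂ) (x : Fin 4 → P2) : Prop where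
  isUnit_det : IsUnit M.det
  mulVec_rep : ∀ i, ∃ c : ℂ, c ≠ 0 ∧ M *ᵥ (x i).rep = c • frameVec i

theorem triple_ne_zero {u v w : Fin 3 → ℂ} (h : LinearIndependent ℂ ![u, v, w]) :
    u ⬝ᵥ (v ⨯₃ w) ≠ 0 := by
  rw [triple_product_eq_det]
  have := (Matrix.linearIndependent_rows_iff_isUnit (A := Matrix.of ![u, v, w])).1 h
  rw [Matrix.isUnit_iff_isUnit_det] at this
  exact this.ne_zero

theorem triple_rep_ne_zero {p q r : P2} (h : Projectivization.Independent ![p, q, r]) :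
    p.rep ⬝ᵥ (q.rep ⨯₃ r.rep) ≠ 0 := by
  rw [Projectivization.independent_iff] at h
  apply triple_ne_zero
  have e : ![p.rep, q.rep, r.rep] = Projectivization.rep ∘ ![p, q, r] := by
    funext i
    fin_cases i <;> rfl
  rw [e]
  exact h

theorem GeneralPosition.triple_ne_zero {n : ℕ} {x : Fin n → P2} (hx : GeneralPosition x)
    {i j k : Fin n} (hij : i ≠ j) (hik : i ≠ k) (hjk : j ≠ k) :
    (x i).rep ⬝ᵥ ((x j).rep ⨯₃ (x k).rep) ≠ 0 := by
  apply triple_rep_ne_zero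
  have hinj : Function.Injective ![i, j, k] := by
    intro s t
    fin_cases s <;> fin_cases t <;> simp [hij, hik, hjk, hij.symm, hik.symm, hjk.symm]
  convert hx ⟨_, hinj⟩ using 1
  funext i
  fin_cases i <;> rfl

theorem triple_mulVec {R : Type*} [CommRing R] (M : Matrix (Fin 3) (Fin 3) R) (u v w : Fin 3 → R) :
    (M *ᵥ u) ⬝ᵥ ((M *ᵥ v) ⨯₃ (M *ᵥ w)) = M.det * (u ⬝ᵥ (v ⨯₃ w)) := by
  simp only [det_fin_three, cross_apply, dotProduct, mulVec, Fin.sum_univ_three, cons_val]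
  ring

/-- Cramer's rule: the rows are the cross products of pairs among the first three points, which
diagonalizes those points. Each row is divided by its value at the fourth point, which sends that
point to `(1, 1, 1)`. -/
theorem GeneralPosition.exists_isNormalizing {x : Fin 4 → P2} (hx : GeneralPosition x) :
    ∃ M, IsNormalizing M x := by
  have d012 := hx.triple_ne_zero (i := 0) (j := 1) (k := 2) (by decide) (by decide) (by decide)
  have d312 := hx.triple_ne_zero (i := 3) (j := 1) (k := 2) (by decide) (by decide) (by decide)
  have d320 := hx.triple_ne_zero (i := 3) (j := 2) (k := 0) (by decide) (by decide) (by decide)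
  have d301 := hx.triple_ne_zero (i := 3) (j := 0) (k := 1) (by decide) (by decide) (by decide)
  generalize hu0 : (x 0).rep = u0 at *
  generalize hu1 : (x 1).rep = u1 at *
  generalize hu2 : (x 2).rep = u2 at *
  generalize hu3 : (x 3).rep = u3 at *
  have hdet : ∀ u : Fin 3 → ℂ, Matrix.of ![(u3 ⬝ᵥ (u1 ⨯₃ u2))⁻¹ • (u1 ⨯₃ u2),
      (u3 ⬝ᵥ (u2 ⨯₃ u0))⁻¹ • (u2 ⨯₃ u0), (u3 ⬝ᵥ (u0 ⨯₃ u1))⁻¹ • (u0 ⨯₃ u1)] *ᵥ u =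
      ![(u3 ⬝ᵥ (u1 ⨯₃ u2))⁻¹ * (u ⬝ᵥ (u1 ⨯₃ u2)), (u3 ⬝ᵥ (u2 ⨯₃ u0))⁻¹ * (u ⬝ᵥ (u2 ⨯₃ u0)),
        (u3 ⬝ᵥ (u0 ⨯₃ u1))⁻¹ * (u ⬝ᵥ (u0 ⨯₃ u1))] := by
    intro u
    have hs : ∀ (c : ℂ) (w : Fin 3 → ℂ), (c • w) ⬝ᵥ u = c * (u ⬝ᵥ w) := fun c w => by
      rw [smul_dotProduct, dotProduct_comm, smul_eq_mul]
    funext i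
    fin_cases i <;> exact hs _ _
  have e1 : u1 ⬝ᵥ (u2 ⨯₃ u0) = u0 ⬝ᵥ (u1 ⨯₃ u2) := by rw [triple_product_permutation u0]
  have e2 : u2 ⬝ᵥ (u0 ⨯₃ u1) = u0 ⬝ᵥ (u1 ⨯₃ u2) := by
    rw [triple_product_permutation u0, triple_product_permutation u1]
  have f0 := hdet u0
  have f1 := hdet u1
  have f2 := hdet u2
  have f3 := hdet u3
  rw [dot_cross_self, dot_self_cross] at f0 f1 f2
  rw [inv_mul_cancel₀ d312, inv_mul_cancel₀ d320, inv_mul_cancel₀ d301] at f3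
  rw [e1] at f1
  rw [e2] at f2
  generalize Matrix.of ![(u3 ⬝ᵥ (u1 ⨯₃ u2))⁻¹ • (u1 ⨯₃ u2),
      (u3 ⬝ᵥ (u2 ⨯₃ u0))⁻¹ • (u2 ⨯₃ u0), (u3 ⬝ᵥ (u0 ⨯₃ u1))⁻¹ • (u0 ⨯₃ u1)] = M at *
  refine ⟨M, ?_, ?_⟩
  -- The images of the first three points are nonzero multiples of the basis vectors, so their
  -- triple product is nonzero and `M.det` cannot vanish.
  · have h := triple_mulVec M u0 u1 u2
    rw [isUnit_iff_ne_zero]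
    intro h0
    rw [h0, f0, f1, f2, zero_mul] at h
    generalize u3 ⬝ᵥ (u1 ⨯₃ u2) = r₀, u3 ⬝ᵥ (u2 ⨯₃ u0) = r₁, u3 ⬝ᵥ (u0 ⨯₃ u1) = r₂,
      u0 ⬝ᵥ (u1 ⨯₃ u2) = r at h d312 d320 d301 d012
    simp [cross_apply, dotProduct, Fin.sum_univ_three, d312, d320, d301, d012] at h
  · intro i
    fin_cases i
    · refine ⟨(u3 ⬝ᵥ (u1 ⨯₃ u2))⁻¹ * (u0 ⬝ᵥ (u1 ⨯₃ u2)), by simp [d012, d312], ?_⟩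
      simp [hu0, f0, frameVec]
    · refine ⟨(u3 ⬝ᵥ (u2 ⨯₃ u0))⁻¹ * (u0 ⬝ᵥ (u1 ⨯₃ u2)), by simp [d012, d320], ?_⟩
      simp [hu1, f1, frameVec]
    · refine ⟨(u3 ⬝ᵥ (u0 ⨯₃ u1))⁻¹ * (u0 ⬝ᵥ (u1 ⨯₃ u2)), by simp [d012, d301], ?_⟩
      simp [hu2, f2, frameVec]
    · refine ⟨1, one_ne_zero, ?_⟩
      simp [hu3, f3, frameVec]

theorem StandardPosition.isNormalizing_one {x : Fin 4 → P2} (hx : StandardPosition x) :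
    IsNormalizing 1 x := by
  refine ⟨by simp, fun i => ?_⟩
  obtain ⟨t, ht⟩ := Projectivization.exists_smul_eq_mk_rep ℂ (frameVec i) (frameVec_ne_zero i)
  exact ⟨t, t.ne_zero, by rw [hx i, ← ht, one_mulVec, Units.smul_def]⟩

theorem linSubst_one_one (p : BiPoly) : linSubst 1 1 p = p := by
  refine MvPolynomial.funext fun w => ?_
  obtain ⟨a, b, rfl⟩ : ∃ a b, w = Sum.elim a b := ⟨_, _, (Sum.elim_comp_inl_inr w).symm⟩
  rw [eval_linSubst, one_mulVec, one_mulVec]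

section Normalized

variable {x y : Fin 4 → P2} {M N : Matrix (Fin 3) (Fin 3) ℂ}

theorem IsNormalizing.mulVec_ne_zero (hM : IsNormalizing M x) {a : Fin 3 → ℂ} (ha : a ≠ 0) :
    M *ᵥ a ≠ 0 := by
  intro h
  apply ha
  rw [← one_mulVec a, ← nonsing_inv_mul M hM.isUnit_det, ← mulVec_mulVec, h, mulVec_zero]

/-- In normalizing coordinates the camera centers variety is given by the standard equation. -/
theorem mem_cameraCenters_iff_tripleForm (hM : IsNormalizing M x) (hN : IsNormalizing N y)
    (p : P2 × P2) :
    p ∈ cameraCenters x y ↔ tripleForm (M *ᵥ p.1.rep) (N *ᵥ p.2.rep) = 0 := by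
  rw [mem_cameraCenters_iff, ← exists_isFrameEpipolar_iff]
  have hMM := mul_nonsing_inv M hM.isUnit_det
  have hMM' := nonsing_inv_mul M hM.isUnit_det
  have hNN := mul_nonsing_inv N hN.isUnit_det
  have hNN' := nonsing_inv_mul N hN.isUnit_det
  have hNt : N⁻¹ᵀ * Nᵀ = 1 := by rw [← transpose_mul, hNN, transpose_one]
  have hNt' : Nᵀ * N⁻¹ᵀ = 1 := by rw [← transpose_mul, hNN', transpose_one]
  constructor
  · rintro ⟨F, hF, h1, h2, h3⟩
    -- The bilinear form of `F` expressed in the new coordinates; the converse uses the inverse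
    -- transport `Nᵀ * F * M`.
    refine ⟨N⁻¹ᵀ * F * M⁻¹, ?_, ?_, ?_, fun i => ?_⟩
    · intro h
      apply hF
      calc F = (Nᵀ * N⁻¹ᵀ) * F * (M⁻¹ * M) := by rw [hNt', hMM', one_mul, mul_one]
        _ = Nᵀ * (N⁻¹ᵀ * F * M⁻¹) * M := by simp only [Matrix.mul_assoc]
        _ = 0 := by rw [h, mul_zero, zero_mul]
    · rw [mulVec_mulVec, Matrix.mul_assoc, hMM', mul_one, ← mulVec_mulVec, h1, mulVec_zero]
    · rw [transpose_mul, transpose_mul, transpose_transpose, mulVec_mulVec, Matrix.mul_assoc,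
        Matrix.mul_assoc, hNN', mul_one, ← mulVec_mulVec, h2, mulVec_zero]
    · obtain ⟨c, hc, hc'⟩ := hM.mulVec_rep i
      obtain ⟨d, hd, hd'⟩ := hN.mulVec_rep i
      have hc'' : M⁻¹ *ᵥ frameVec i = c⁻¹ • (x i).rep := by
        rw [← inv_smul_smul₀ hc (frameVec i), ← hc', mulVec_smul, mulVec_mulVec, hMM', one_mulVec]
      have hd'' : N⁻¹ *ᵥ frameVec i = d⁻¹ • (y i).rep := by
        rw [← inv_smul_smul₀ hd (frameVec i), ← hd', mulVec_smul, mulVec_mulVec, hNN', one_mulVec]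
      rw [← mulVec_mulVec, hc'', ← mulVec_mulVec, dotProduct_transpose_mulVec, hd'',
        mulVec_smul, dotProduct_smul, smul_dotProduct, dotProduct_comm, h3, smul_zero, smul_zero]
  · rintro ⟨F, hF, h1, h2, h3⟩
    refine ⟨Nᵀ * F * M, ?_, ?_, ?_, fun i => ?_⟩
    · intro h
      apply hF
      calc F = (N⁻¹ᵀ * Nᵀ) * F * (M * M⁻¹) := by rw [hNt, hMM, one_mul, mul_one]
        _ = N⁻¹ᵀ * (Nᵀ * F * M) * M⁻¹ := by simp only [Matrix.mul_assoc]
        _ = 0 := by rw [h, mul_zero, zero_mul]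
    · rw [← mulVec_mulVec, ← mulVec_mulVec, h1, mulVec_zero]
    · rw [transpose_mul, transpose_mul, transpose_transpose, ← mulVec_mulVec, ← mulVec_mulVec,
        h2, mulVec_zero]
    · obtain ⟨c, hc, hc'⟩ := hM.mulVec_rep i
      obtain ⟨d, hd, hd'⟩ := hN.mulVec_rep i
      rw [← mulVec_mulVec, hc', ← mulVec_mulVec, dotProduct_transpose_mulVec, hd',
        mulVec_smul, dotProduct_smul, smul_dotProduct, dotProduct_comm, h3, smul_zero, smul_zero]

theorem isHypersurfaceOfBidegree_cameraCenters (hM : IsNormalizing M x) (hN : IsNormalizing N y) :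
    IsHypersurfaceOfBidegree (cameraCenters x y) 2 2 := by
  refine ⟨linSubst M N standardEquation, ?_, isBihomogeneous_linSubst_standardEquation M N,
    isEquationOf_linSubst hM.isUnit_det hN.isUnit_det (mem_cameraCenters_iff_tripleForm hM hN)⟩
  intro h
  apply prime_standardEquation.ne_zero
  rw [← linSubst_linSubst (mul_nonsing_inv M hM.isUnit_det) (mul_nonsing_inv N hN.isUnit_det)
    standardEquation, h, map_zero]

/-- The triple form vanishes on the diagonal, so `E` contains the graph of the homography `N⁻¹ M`
matching the two frames. -/
theorem image_fst_cameraCenters (hM : IsNormalizing M x) (hN : IsNormalizing N y) :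
    Prod.fst '' cameraCenters x y = Set.univ := by
  refine Set.eq_univ_of_forall fun a => ?_
  have hb : N⁻¹ *ᵥ (M *ᵥ a.rep) ≠ 0 := by
    intro h
    apply hM.mulVec_ne_zero a.rep_nonzero
    rw [← one_mulVec (M *ᵥ a.rep), ← mul_nonsing_inv N hN.isUnit_det, ← mulVec_mulVec, h,
      mulVec_zero]
  refine ⟨(a, Projectivization.mk ℂ _ hb), ?_, rfl⟩
  rw [mem_cameraCenters_iff_tripleForm hM hN]
  obtain ⟨t, ht⟩ := Projectivization.exists_smul_eq_mk_rep ℂ _ hb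
  have hb' : N *ᵥ (Projectivization.mk ℂ _ hb).rep = (t : ℂ) • (M *ᵥ a.rep) := by
    rw [← ht, Units.smul_def, mulVec_smul, mulVec_mulVec, mul_nonsing_inv N hN.isUnit_det,
      one_mulVec]
  have := tripleForm_smul_smul 1 (t : ℂ) (M *ᵥ a.rep) (M *ᵥ a.rep)
  rw [one_smul, tripleForm_self, mul_zero] at this
  rw [hb', this]

/-! ### Fibers as conics. -/

/-- Twice the symmetric matrix of the quadratic form `b ↦ tripleForm a b`. -/
def fiberMatrix {R : Type*} [CommRing R] (a : Fin 3 → R) : Matrix (Fin 3) (Fin 3) R :=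
  !![0, a 2 * (a 0 - a 1), a 1 * (a 2 - a 0);
     a 2 * (a 0 - a 1), 0, a 0 * (a 1 - a 2);
     a 1 * (a 2 - a 0), a 0 * (a 1 - a 2), 0]

theorem dotProduct_fiberMatrix {R : Type*} [CommRing R] (a b : Fin 3 → R) :
    b ⬝ᵥ (fiberMatrix a *ᵥ b) = 2 * tripleForm a b := by
  simp [tripleForm_eq, fiberMatrix, dotProduct, mulVec, Fin.sum_univ_three]
  ring

theorem fiberMatrix_isSymm {R : Type*} [CommRing R] (a : Fin 3 → R) : (fiberMatrix a).IsSymm := by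
  ext i j
  fin_cases i <;> fin_cases j <;> rfl

theorem det_fiberMatrix {R : Type*} [CommRing R] (a : Fin 3 → R) : (fiberMatrix a).det =
    2 * (a 0 * (a 1 - a 2)) * (a 1 * (a 2 - a 0)) * (a 2 * (a 0 - a 1)) := by
  simp [fiberMatrix, det_fin_three]
  ring

theorem dotProduct_congruence {R : Type*} [CommRing R] (N S : Matrix (Fin 3) (Fin 3) R)
    (b : Fin 3 → R) : b ⬝ᵥ ((Nᵀ * S * N) *ᵥ b) = (N *ᵥ b) ⬝ᵥ (S *ᵥ (N *ᵥ b)) := by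
  rw [← mulVec_mulVec, ← mulVec_mulVec, dotProduct_transpose_mulVec, dotProduct_comm]

theorem isSymm_congruence {R : Type*} [CommRing R] (N : Matrix (Fin 3) (Fin 3) R)
    {S : Matrix (Fin 3) (Fin 3) R} (hS : S.IsSymm) : (Nᵀ * S * N).IsSymm := by
  rw [Matrix.IsSymm, transpose_mul, transpose_mul, transpose_transpose, hS.eq, Matrix.mul_assoc]

theorem fiberOverFst_cameraCenters (hM : IsNormalizing M x) (hN : IsNormalizing N y) (a : P2) :
    fiberOverFst (cameraCenters x y) a = quadric (Nᵀ * fiberMatrix (M *ᵥ a.rep) * N) := by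
  ext b
  simp only [fiberOverFst, quadric, Set.mem_ofPred_eq, dotProduct_congruence,
    dotProduct_fiberMatrix]
  constructor
  · rintro ⟨⟨a', b'⟩, ⟨hE, rfl⟩, rfl⟩
    rw [mem_cameraCenters_iff_tripleForm hM hN] at hE
    simpa using hE
  · intro h
    refine ⟨(a, b), ⟨?_, rfl⟩, rfl⟩
    rw [mem_cameraCenters_iff_tripleForm hM hN]
    simpa using h

theorem two_le_rank_of_minor {S : Matrix (Fin 3) (Fin 3) ℂ} (i j k l : Fin 3)
    (h : S i k * S j l - S i l * S j k ≠ 0) : 2 ≤ S.rank := by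
  have hu : IsUnit (S.submatrix ![i, j] ![k, l]) := by
    rw [Matrix.isUnit_iff_isUnit_det, det_fin_two]
    simpa using h
  have h2 : (S.submatrix ![i, j] ![k, l]).rank = 2 := rank_of_isUnit _ hu
  exact h2.symm.le.trans (rank_submatrix_le S _ _)

/-- Since the diagonal is zero, each principal `2 × 2` minor is minus the square of an off-diagonal
entry. Rank below two thus kills all three entries, and their common zeros are the multiples of the
frame vectors. -/
theorem two_le_rank_fiberMatrix (hM : IsNormalizing M x) {a : P2} (ha : ∀ i, a ≠ x i) :
    2 ≤ (fiberMatrix (M *ᵥ a.rep)).rank := by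
  have hne : ∀ (i : Fin 4) (c : ℂ), M *ᵥ a.rep ≠ c • frameVec i := by
    intro i c h
    obtain ⟨d, hd, hd'⟩ := hM.mulVec_rep i
    apply ha i
    rw [← a.mk_rep, ← (x i).mk_rep, Projectivization.mk_eq_mk_iff']
    refine ⟨c * d⁻¹, ?_⟩
    rw [← one_mulVec a.rep, ← one_mulVec (x i).rep, ← nonsing_inv_mul M hM.isUnit_det,
      ← mulVec_mulVec, ← mulVec_mulVec, hd', h, ← mulVec_smul, smul_smul, mul_assoc,
      inv_mul_cancel₀ hd, mul_one]
  generalize M *ᵥ a.rep = v at *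
  by_contra hr
  have h0 : v 0 * (v 1 - v 2) = 0 := by
    by_contra h
    exact hr (two_le_rank_of_minor 1 2 1 2 (by simpa [fiberMatrix] using h))
  have h1 : v 1 * (v 2 - v 0) = 0 := by
    by_contra h
    exact hr (two_le_rank_of_minor 0 2 0 2 (by simpa [fiberMatrix] using h))
  have h2 : v 2 * (v 0 - v 1) = 0 := by
    by_contra h
    exact hr (two_le_rank_of_minor 0 1 0 1 (by simpa [fiberMatrix] using h))
  have hex : ∃ i : Fin 4, ∃ c : ℂ, v = c • frameVec i := by
    have ext3 : ∀ w : Fin 3 → ℂ, v 0 = w 0 → v 1 = w 1 → v 2 = w 2 → v = w := by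
      intro w h0 h1 h2
      funext i
      fin_cases i <;> assumption
    simp only [mul_eq_zero, sub_eq_zero] at h0 h1 h2
    by_cases z0 : v 0 = 0
    · by_cases z1 : v 1 = 0
      · exact ⟨2, v 2, ext3 _ (by simp [frameVec, z0]) (by simp [frameVec, z1])
          (by simp [frameVec])⟩
      · have z2 : v 2 = 0 := by simpa [z0, z1] using h1
        exact ⟨1, v 1, ext3 _ (by simp [frameVec, z0]) (by simp [frameVec])
          (by simp [frameVec, z2])⟩
    · have z12 : v 1 = v 2 := by simpa [z0] using h0
      by_cases z1 : v 1 = 0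
      · exact ⟨0, v 0, ext3 _ (by simp [frameVec]) (by simp [frameVec, z1])
          (by simp [frameVec, ← z12, z1])⟩
      · have z20 : v 2 = v 0 := by simpa [z1] using h1
        exact ⟨3, v 0, ext3 _ (by simp [frameVec]) (by simp [frameVec, z12, z20])
          (by simp [frameVec, z20])⟩
  obtain ⟨i, c, h⟩ := hex
  exact hne i c h

theorem rank_congruence (hN : IsUnit N.det) (S : Matrix (Fin 3) (Fin 3) ℂ) :
    (Nᵀ * S * N).rank = S.rank := by
  rw [rank_mul_eq_left_of_isUnit_det _ _ hN, rank_mul_eq_right_of_isUnit_det]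
  rwa [det_transpose]

theorem isConic_fiberOverFst (hM : IsNormalizing M x) (hN : IsNormalizing N y) {a : P2}
    (ha : ∀ i, a ≠ x i) : IsConic (fiberOverFst (cameraCenters x y) a) :=
  ⟨_, isSymm_congruence N (fiberMatrix_isSymm _),
    by rw [rank_congruence hN.isUnit_det]; exact two_le_rank_fiberMatrix hM ha,
    fiberOverFst_cameraCenters hM hN a⟩

/-- The six linear factors of the determinant are, up to sign, the equations of the six lines
through pairs of frame points. -/
theorem det_fiberMatrix_ne_zero (hM : IsNormalizing M x) {a : P2} (ha : OffLines x a) :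
    (fiberMatrix (M *ᵥ a.rep)).det ≠ 0 := by
  have key : ∀ i j, i ≠ j → frameVec i ⬝ᵥ (frameVec j ⨯₃ (M *ᵥ a.rep)) ≠ 0 := by
    intro i j hij h
    have hne := triple_rep_ne_zero (ha i j hij)
    obtain ⟨c, hc, hc'⟩ := hM.mulVec_rep i
    obtain ⟨d, hd, hd'⟩ := hM.mulVec_rep j
    have := triple_mulVec M (x i).rep (x j).rep a.rep
    rw [hc', hd', LinearMap.map_smul₂, smul_dotProduct, dotProduct_smul, h, smul_zero,
      smul_zero] at this
    exact mul_ne_zero hM.isUnit_det.ne_zero hne this.symm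
  generalize M *ᵥ a.rep = v at *
  have k12 := key 1 2 (by decide)
  have k20 := key 2 0 (by decide)
  have k01 := key 0 1 (by decide)
  have k03 := key 0 3 (by decide)
  have k13 := key 1 3 (by decide)
  have k23 := key 2 3 (by decide)
  simp [frameVec, cross_apply, dotProduct, Fin.sum_univ_three, sub_eq_zero]
    at k12 k20 k01 k03 k13 k23
  rw [det_fiberMatrix]
  simp only [ne_eq, mul_eq_zero, sub_eq_zero, not_or]
  exact ⟨⟨⟨two_ne_zero, k12, fun h => k03 h.symm⟩, k20, fun h => k13 h.symm⟩,
    k01, fun h => k23 h.symm⟩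

theorem isNondegenerateConic_fiberOverFst (hM : IsNormalizing M x) (hN : IsNormalizing N y)
    {a : P2} (ha : OffLines x a) :
    IsNondegenerateConic (fiberOverFst (cameraCenters x y) a) := by
  refine ⟨_, isSymm_congruence N (fiberMatrix_isSymm _), ?_, fiberOverFst_cameraCenters hM hN a⟩
  rw [det_mul, det_mul, det_transpose]
  exact mul_ne_zero (mul_ne_zero hN.isUnit_det.ne_zero (det_fiberMatrix_ne_zero hM ha))
    hN.isUnit_det.ne_zero

end Normalized

/-! ### Intersection of a line with a conic. -/

theorem exists_cross_eq (v : Fin 3 → ℂ) : ∃ w₁ w₂ : Fin 3 → ℂ, w₁ ⨯₃ w₂ = v := by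
  by_cases h2 : v 2 = 0
  · by_cases h1 : v 1 = 0
    · refine ⟨![0, v 0, 0], ![0, 0, 1], ?_⟩
      funext i
      fin_cases i <;> simp [cross_apply, h1, h2]
    · refine ⟨![v 1, -v 0, 0], ![0, 0, -1], ?_⟩
      funext i
      fin_cases i <;> simp [cross_apply, h2]
  · refine ⟨![v 2, 0, -v 0], ![0, 1, -v 1 / v 2], ?_⟩
    funext i
    fin_cases i <;> simp [cross_apply]
    field_simp

theorem exists_apply_ne_zero {v : Fin 3 → ℂ} (hv : v ≠ 0) : v 0 ≠ 0 ∨ v 1 ≠ 0 ∨ v 2 ≠ 0 := by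
  by_contra! h
  apply hv
  funext i
  fin_cases i
  exacts [h.1, h.2.1, h.2.2]

theorem exists_eq_smul_add_smul {p w₁ w₂ : Fin 3 → ℂ} (hw : w₁ ⨯₃ w₂ ≠ 0)
    (hp : (w₁ ⨯₃ w₂) ⬝ᵥ p = 0) : ∃ s t : ℂ, p = s • w₁ + t • w₂ := by
  have hne := exists_apply_ne_zero hw
  have ext3 : ∀ w : Fin 3 → ℂ, p 0 = w 0 → p 1 = w 1 → p 2 = w 2 → p = w := by
    intro w h0 h1 h2
    funext i
    fin_cases i <;> assumption
  simp only [cross_apply, dotProduct, Fin.sum_univ_three, cons_val] at hp hne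
  rcases hne with h | h | h
  · generalize hd : w₁ 1 * w₂ 2 - w₁ 2 * w₂ 1 = d at h
    refine ⟨(p 1 * w₂ 2 - p 2 * w₂ 1) / d,
      (w₁ 1 * p 2 - w₁ 2 * p 1) / d, ext3 _ ?_ ?_ ?_⟩ <;>
    simp only [Pi.add_apply, Pi.smul_apply, smul_eq_mul] <;> field_simp <;> rw [← hd]
    · linear_combination hp
    · ring
    · ring
  · generalize hd : w₁ 2 * w₂ 0 - w₁ 0 * w₂ 2 = d at h
    refine ⟨(p 2 * w₂ 0 - p 0 * w₂ 2) / d,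
      (w₁ 2 * p 0 - w₁ 0 * p 2) / d, ext3 _ ?_ ?_ ?_⟩ <;>
    simp only [Pi.add_apply, Pi.smul_apply, smul_eq_mul] <;> field_simp <;> rw [← hd]
    · ring
    · linear_combination hp
    · ring
  · generalize hd : w₁ 0 * w₂ 1 - w₁ 1 * w₂ 0 = d at h
    refine ⟨(p 0 * w₂ 1 - p 1 * w₂ 0) / d,
      (w₁ 0 * p 1 - w₁ 1 * p 0) / d, ext3 _ ?_ ?_ ?_⟩ <;>
    simp only [Pi.add_apply, Pi.smul_apply, smul_eq_mul] <;> field_simp <;> rw [← hd]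
    · ring
    · ring
    · linear_combination hp

theorem exists_eq_smul_cross {p u₁ u₂ : Fin 3 → ℂ} (hu : u₁ ⨯₃ u₂ ≠ 0) (h₁ : u₁ ⬝ᵥ p = 0)
    (h₂ : u₂ ⬝ᵥ p = 0) : ∃ t : ℂ, t • (u₁ ⨯₃ u₂) = p := by
  have hne := exists_apply_ne_zero hu
  have ext3 : ∀ w : Fin 3 → ℂ, w 0 = p 0 → w 1 = p 1 → w 2 = p 2 → w = p := by
    intro w h0 h1 h2
    funext i
    fin_cases i <;> assumption
  simp only [cross_apply, dotProduct, Fin.sum_univ_three, cons_val] at h₁ h₂ hne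
  rcases hne with h | h | h
  · refine ⟨p 0 / (u₁ 1 * u₂ 2 - u₁ 2 * u₂ 1), ext3 _ ?_ ?_ ?_⟩ <;>
    simp only [Pi.smul_apply, smul_eq_mul, cross_apply, cons_val] <;> field_simp
    · linear_combination u₁ 2 * h₂ - u₂ 2 * h₁
    · linear_combination u₂ 1 * h₁ - u₁ 1 * h₂
  · refine ⟨p 1 / (u₁ 2 * u₂ 0 - u₁ 0 * u₂ 2), ext3 _ ?_ ?_ ?_⟩ <;>
    simp only [Pi.smul_apply, smul_eq_mul, cross_apply, cons_val] <;> field_simp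
    · linear_combination u₂ 2 * h₁ - u₁ 2 * h₂
    · linear_combination u₁ 0 * h₂ - u₂ 0 * h₁
  · refine ⟨p 2 / (u₁ 0 * u₂ 1 - u₁ 1 * u₂ 0), ext3 _ ?_ ?_ ?_⟩ <;>
    simp only [Pi.smul_apply, smul_eq_mul, cross_apply, cons_val] <;> field_simp
    · linear_combination u₁ 1 * h₂ - u₂ 1 * h₁
    · linear_combination u₂ 0 * h₁ - u₁ 0 * h₂

theorem dotProduct_mulVec_comm {S : Matrix (Fin 3) (Fin 3) ℂ} (hS : S.IsSymm)
    (u v : Fin 3 → ℂ) : u ⬝ᵥ (S *ᵥ v) = v ⬝ᵥ (S *ᵥ u) := by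
  rw [← dotProduct_transpose_mulVec, hS.eq]

theorem dotProduct_mulVec_combination {S : Matrix (Fin 3) (Fin 3) ℂ} (hS : S.IsSymm)
    (u v : Fin 3 → ℂ) (s t s' t' : ℂ) :
    (s • u + t • v) ⬝ᵥ (S *ᵥ (s' • u + t' • v)) = s * s' * (u ⬝ᵥ (S *ᵥ u)) +
      (s * t' + t * s') * (u ⬝ᵥ (S *ᵥ v)) + t * t' * (v ⬝ᵥ (S *ᵥ v)) := by
  simp only [mulVec_add, mulVec_smul, add_dotProduct, dotProduct_add, smul_dotProduct,
    dotProduct_smul, smul_eq_mul, dotProduct_mulVec_comm hS v u]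
  ring

/-- The Gram determinant of a symmetric form on the plane spanned by two vectors. -/
theorem cross_dotProduct_adjugate {S : Matrix (Fin 3) (Fin 3) ℂ} (hS : S.IsSymm)
    (u v : Fin 3 → ℂ) : (u ⨯₃ v) ⬝ᵥ (S.adjugate *ᵥ (u ⨯₃ v)) =
      (u ⬝ᵥ (S *ᵥ u)) * (v ⬝ᵥ (S *ᵥ v)) - (u ⬝ᵥ (S *ᵥ v)) ^ 2 := by
  have h1 := hS.apply 0 1
  have h2 := hS.apply 0 2
  have h3 := hS.apply 1 2
  simp only [adjugate_fin_three, cross_apply, dotProduct, mulVec, Fin.sum_univ_three, cons_val,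
    of_apply, h1, h2, h3]
  ring

theorem cross_combination (u v : Fin 3 → ℂ) (s t s' t' : ℂ) :
    (s • u + t • v) ⨯₃ (s' • u + t' • v) = (s * t' - t * s') • (u ⨯₃ v) := by
  funext i
  fin_cases i <;> simp [cross_apply] <;> ring

/-- If a symmetric form is nondegenerate on the plane orthogonal to `v`, then this plane is spanned
by two isotropic vectors. -/
theorem exists_isotropic_pair {S : Matrix (Fin 3) (Fin 3) ℂ} (hS : S.IsSymm) {v : Fin 3 → ℂ}
    (h : v ⬝ᵥ (S.adjugate *ᵥ v) ≠ 0) : ∃ (p q : Fin 3 → ℂ) (k : ℂ), k ≠ 0 ∧ p ⨯₃ q = k • v ∧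
      p ⬝ᵥ (S *ᵥ p) = 0 ∧ q ⬝ᵥ (S *ᵥ q) = 0 ∧ p ⬝ᵥ (S *ᵥ q) ≠ 0 := by
  obtain ⟨w₁, w₂, rfl⟩ := exists_cross_eq v
  rw [cross_dotProduct_adjugate hS] at h
  by_cases hα : w₁ ⬝ᵥ (S *ᵥ w₁) = 0
  · rw [hα] at h
    have hβ : w₁ ⬝ᵥ (S *ᵥ w₂) ≠ 0 := by
      intro h0
      simp [h0] at h
    -- Here `w₁` is already isotropic and the restricted form is `2 β s t + γ t²`, with second root
    -- `(-γ, 2 β)`.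
    refine ⟨(1 : ℂ) • w₁ + (0 : ℂ) • w₂, (-(w₂ ⬝ᵥ (S *ᵥ w₂))) • w₁ + (2 * (w₁ ⬝ᵥ (S *ᵥ w₂))) • w₂,
      2 * (w₁ ⬝ᵥ (S *ᵥ w₂)), by simp [hβ], ?_, ?_, ?_, ?_⟩
    · rw [cross_combination]
      congr 1
      ring
    · rw [dotProduct_mulVec_combination hS, hα]
      ring
    · rw [dotProduct_mulVec_combination hS, hα]
      ring
    · rw [dotProduct_mulVec_combination hS, hα]
      simp [hβ]
  · obtain ⟨δ, hδ⟩ := IsAlgClosed.exists_pow_nat_eq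
      ((w₁ ⬝ᵥ (S *ᵥ w₂)) ^ 2 - (w₁ ⬝ᵥ (S *ᵥ w₁)) * (w₂ ⬝ᵥ (S *ᵥ w₂))) (n := 2) (by norm_num)
    have hδ0 : δ ≠ 0 := by
      rintro rfl
      apply h
      linear_combination hδ
    have e := dotProduct_mulVec_combination hS w₁ w₂
    have e' := cross_combination w₁ w₂
    generalize w₁ ⬝ᵥ (S *ᵥ w₁) = α, w₁ ⬝ᵥ (S *ᵥ w₂) = β, w₂ ⬝ᵥ (S *ᵥ w₂) = γ at *
    -- The two roots of `α s² + 2 β s t + γ t²` from the quadratic formula, scaled by `α`.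
    refine ⟨(-β + δ) • w₁ + α • w₂, (-β - δ) • w₁ + α • w₂, 2 * δ * α, by simp [hα, hδ0],
      ?_, ?_, ?_, ?_⟩
    · rw [e']
      congr 1
      ring
    · rw [e]
      linear_combination α * hδ
    · rw [e]
      linear_combination α * hδ
    · rw [e]
      have : (-β + δ) * (-β - δ) * α + ((-β + δ) * α + α * (-β - δ)) * β + α * α * γ =
          -(2 * δ ^ 2 * α) := by
        linear_combination α * hδ
      rw [this]
      simp [hα, hδ0]

/-- A line that is not tangent to a conic meets it in exactly two points. -/
theorem encard_line_inter_quadric {S : Matrix (Fin 3) (Fin 3) ℂ} (hS : S.IsSymm) {v : Fin 3 → ℂ}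
    (h : v ⬝ᵥ (S.adjugate *ᵥ v) ≠ 0) : {p : P2 | v ⬝ᵥ p.rep = 0 ∧ p ∈ quadric S}.encard = 2 := by
  obtain ⟨p, q, k, hk, hpq, hp, hq, hpSq⟩ := exists_isotropic_pair hS h
  have hv : v ≠ 0 := by
    rintro rfl
    simp at h
  have hp0 : p ≠ 0 := by
    rintro rfl
    simp at hpSq
  have hq0 : q ≠ 0 := by
    rintro rfl
    simp at hpSq
  have hvp : v ⬝ᵥ p = 0 := by
    have : (k • v) ⬝ᵥ p = 0 := by rw [← hpq, dotProduct_comm, dot_self_cross]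
    simpa [hk] using this
  have hvq : v ⬝ᵥ q = 0 := by
    have : (k • v) ⬝ᵥ q = 0 := by rw [← hpq, dotProduct_comm, dot_cross_self]
    simpa [hk] using this
  have hmem : ∀ (r : Fin 3 → ℂ) (hr : r ≠ 0), v ⬝ᵥ r = 0 → r ⬝ᵥ (S *ᵥ r) = 0 →
      v ⬝ᵥ (Projectivization.mk ℂ r hr).rep = 0 ∧ Projectivization.mk ℂ r hr ∈ quadric S := by
    intro r hr h1 h2
    obtain ⟨t, ht⟩ := Projectivization.exists_smul_eq_mk_rep ℂ r hr
    simp only [quadric, Set.mem_ofPred_eq, ← ht, Units.smul_def, mulVec_smul, dotProduct_smul,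
      smul_dotProduct, h1, h2, smul_zero, and_self]
  have hset : {p : P2 | v ⬝ᵥ p.rep = 0 ∧ p ∈ quadric S} =
      {Projectivization.mk ℂ p hp0, Projectivization.mk ℂ q hq0} := by
    ext r
    simp only [Set.mem_ofPred_eq, Set.mem_insert_iff, Set.mem_singleton_iff]
    constructor
    · rintro ⟨h1, h2⟩
      obtain ⟨s, t, hst⟩ := exists_eq_smul_add_smul (p := r.rep) (w₁ := p) (w₂ := q)
        (by rw [hpq]; exact smul_ne_zero hk hv) (by rw [hpq, smul_dotProduct, h1, smul_zero])
      rw [quadric, Set.mem_ofPred_eq, hst, dotProduct_mulVec_combination hS, hp, hq] at h2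
      -- In the isotropic basis the form is a nonzero multiple of `s * t`.
      have hst0 : s = 0 ∨ t = 0 := by
        have : 2 * (s * t) * (p ⬝ᵥ (S *ᵥ q)) = 0 := by linear_combination h2
        simpa [hpSq] using this
      rw [← r.mk_rep, Projectivization.mk_eq_mk_iff', Projectivization.mk_eq_mk_iff', hst]
      rcases hst0 with rfl | rfl
      · exact Or.inr ⟨t, by simp⟩
      · exact Or.inl ⟨s, by simp⟩
    · rintro (rfl | rfl)
      · exact hmem p hp0 hvp hp
      · exact hmem q hq0 hvq hq
  rw [hset, Set.encard_pair]
  intro heq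
  rw [Projectivization.mk_eq_mk_iff'] at heq
  obtain ⟨t, rfl⟩ := heq
  rw [smul_dotProduct, hq, smul_zero] at hpSq
  exact hpSq rfl

/-! ### Multidegrees. -/

/-- The discriminant of the points `(a, b)` with `a` on the lines `u₁`, `u₂` and `b` on the line
`v` of the variety `tripleForm (M a) (N b) = 0`. -/
def sliceDiscriminant {R : Type*} [CommRing R] (M N : Matrix (Fin 3) (Fin 3) R)
    (u₁ u₂ v : Fin 3 → R) : R :=
  v ⬝ᵥ ((Nᵀ * fiberMatrix (M *ᵥ (u₁ ⨯₃ u₂)) * N).adjugate *ᵥ v)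

/-- Allows the discriminant of indeterminate lines to serve as the genericity polynomial: evaluating
it gives the discriminant of the actual lines. -/
theorem map_sliceDiscriminant {R S : Type*} [CommRing R] [CommRing S] (φ : R →+* S)
    (M N : Matrix (Fin 3) (Fin 3) R) (u₁ u₂ v : Fin 3 → R) :
    φ (sliceDiscriminant M N u₁ u₂ v) =
      sliceDiscriminant (M.map φ) (N.map φ) (φ ∘ u₁) (φ ∘ u₂) (φ ∘ v) := by
  have hc : φ ∘ (u₁ ⨯₃ u₂) = (φ ∘ u₁) ⨯₃ (φ ∘ u₂) := by
    funext i
    fin_cases i <;> simp [cross_apply]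
  have hf : ∀ a : Fin 3 → R, (fiberMatrix a).map φ = fiberMatrix (φ ∘ a) := by
    intro a
    ext i j
    fin_cases i <;> fin_cases j <;> simp [fiberMatrix]
  have hm : ∀ (A : Matrix (Fin 3) (Fin 3) R) (w : Fin 3 → R),
      φ ∘ (A *ᵥ w) = A.map φ *ᵥ (φ ∘ w) := by
    intro A w
    funext i
    simp [mulVec, dotProduct]
  have ha : ∀ A : Matrix (Fin 3) (Fin 3) R, A.adjugate.map φ = (A.map φ).adjugate :=
    fun A => RingHom.map_adjugate φ A
  rw [sliceDiscriminant, RingHom.map_dotProduct, hm, ha, Matrix.map_mul, Matrix.map_mul, hf, hm,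
    hc, transpose_map]
  rfl

theorem exists_sliceDiscriminant_ne_zero {M N : Matrix (Fin 3) (Fin 3) ℂ} (hM : IsUnit M.det)
    (hN : IsUnit N.det) : ∃ u₁ u₂ v, sliceDiscriminant M N u₁ u₂ v ≠ 0 := by
  -- In normalized coordinates `a = (1, 1, 0)` has the line pair `b₂ (b₁ - b₀) = 0` as fiber, and
  -- the line `b₀ = 0` meets it in two distinct points.
  obtain ⟨u₁, u₂, hu⟩ := exists_cross_eq (M⁻¹ *ᵥ ![1, 1, 0])
  refine ⟨u₁, u₂, Nᵀ *ᵥ ![1, 0, 0], ?_⟩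
  rw [sliceDiscriminant, hu, mulVec_mulVec _ M, mul_nonsing_inv M hM, one_mulVec,
    adjugate_mul_distrib, adjugate_mul_distrib, mulVec_mulVec, Matrix.mul_assoc, Matrix.mul_assoc, adjugate_mul,
    ← mulVec_mulVec, dotProduct_comm, dotProduct_transpose_mulVec, mulVec_mulVec,
    mul_adjugate]
  simp [adjugate_fin_three, fiberMatrix, dotProduct, Fin.sum_univ_three, smul_mulVec,
    hN.ne_zero]

theorem hasMultidegree_cameraCenters {x y : Fin 4 → P2} {M N : Matrix (Fin 3) (Fin 3) ℂ}
    (hM : IsNormalizing M x) (hN : IsNormalizing N y) :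
    HasMultidegree (cameraCenters x y) 2 1 2 := by
  let G : MvPolynomial ((Fin 2 × Fin 3) ⊕ (Fin 1 × Fin 3)) ℂ :=
    sliceDiscriminant (M.map C) (N.map C) (fun i => X (Sum.inl (0, i)))
      (fun i => X (Sum.inl (1, i))) (fun i => X (Sum.inr (0, i)))
  have hG : ∀ (u : Fin 2 → Fin 3 → ℂ) (v : Fin 1 → Fin 3 → ℂ),
      eval (Sum.elim (fun t => u t.1 t.2) (fun t => v t.1 t.2)) G =
        sliceDiscriminant M N (u 0) (u 1) (v 0) := by
    intro u v
    rw [map_sliceDiscriminant]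
    congr 1
    · ext i j
      simp
    · ext i j
      simp
    · funext i
      simp
    · funext i
      simp
    · funext i
      simp
  refine ⟨G, ?_, fun u v huv => ?_⟩
  · obtain ⟨u₁, u₂, v, h⟩ := exists_sliceDiscriminant_ne_zero hM.isUnit_det hN.isUnit_det
    intro h0
    have := hG ![u₁, u₂] ![v]
    rw [h0, map_zero] at this
    exact h this.symm
  · rw [hG, sliceDiscriminant] at huv
    -- A nonzero discriminant already forces the two lines of the first plane to be distinct, so `a`
    -- is their unique intersection point.
    have hc : u 0 ⨯₃ u 1 ≠ 0 := by
      intro h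
      apply huv
      have : fiberMatrix (0 : Fin 3 → ℂ) = 0 := by
        ext i j
        fin_cases i <;> fin_cases j <;> simp [fiberMatrix]
      simp [h, this, adjugate_zero]
    obtain ⟨t, ht⟩ := Projectivization.exists_smul_eq_mk_rep ℂ _ hc
    have hslice : slice (cameraCenters x y) u v =
        Prod.mk (Projectivization.mk ℂ _ hc) '' {p : P2 | v 0 ⬝ᵥ p.rep = 0 ∧
          p ∈ quadric (Nᵀ * fiberMatrix (M *ᵥ (u 0 ⨯₃ u 1)) * N)} := by
      have hE : ∀ b : P2, (Projectivization.mk ℂ _ hc, b) ∈ cameraCenters x y ↔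
          b ∈ quadric (Nᵀ * fiberMatrix (M *ᵥ (u 0 ⨯₃ u 1)) * N) := by
        intro b
        rw [mem_cameraCenters_iff_tripleForm hM hN, quadric, Set.mem_ofPred_eq,
          dotProduct_congruence, dotProduct_fiberMatrix, ← ht, Units.smul_def, mulVec_smul]
        have := tripleForm_smul_smul (t : ℂ) 1 (M *ᵥ (u 0 ⨯₃ u 1)) (N *ᵥ b.rep)
        rw [one_smul] at this
        rw [this]
        simp
      ext ⟨a, b⟩
      simp only [slice, Set.mem_ofPred_eq, Fin.forall_fin_two, Fin.forall_fin_one, Set.mem_image,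
        Prod.mk.injEq]
      constructor
      · rintro ⟨hab, ⟨h0, h1⟩, hv⟩
        obtain ⟨s, hs⟩ := exists_eq_smul_cross hc h0 h1
        have ha : Projectivization.mk ℂ _ hc = a := by
          rw [← a.mk_rep, eq_comm, Projectivization.mk_eq_mk_iff']
          exact ⟨s, hs⟩
        refine ⟨b, ⟨hv, ?_⟩, ha, rfl⟩
        rwa [← hE, ha]
      · rintro ⟨b', ⟨hv, hb⟩, rfl, rfl⟩
        refine ⟨(hE _).2 hb, ⟨?_, ?_⟩, hv⟩
        · rw [← ht, Units.smul_def, dotProduct_smul, dot_self_cross, smul_zero]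
        · rw [← ht, Units.smul_def, dotProduct_smul, dot_cross_self, smul_zero]
    rw [hslice, (Prod.mk_right_injective _).encard_image,
      encard_line_inter_quadric (isSymm_congruence N (fiberMatrix_isSymm _)) huv]
    rfl

/-! ### Exchange of the two planes. -/

theorem image_snd_cameraCenters {n : ℕ} (x y : Fin n → P2) :
    Prod.snd '' cameraCenters x y = Prod.fst '' cameraCenters y x := by
  ext b
  constructor
  · rintro ⟨p, hp, rfl⟩
    exact ⟨p.swap, mem_cameraCenters_swap.2 hp, rfl⟩
  · rintro ⟨p, hp, rfl⟩
    exact ⟨p.swap, mem_cameraCenters_swap.2 hp, rfl⟩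

theorem fiberOverSnd_cameraCenters {n : ℕ} (x y : Fin n → P2) (b : P2) :
    fiberOverSnd (cameraCenters x y) b = fiberOverFst (cameraCenters y x) b := by
  ext a
  constructor
  · rintro ⟨p, ⟨hp, hb⟩, rfl⟩
    exact ⟨p.swap, ⟨mem_cameraCenters_swap.2 hp, hb⟩, rfl⟩
  · rintro ⟨p, ⟨hp, hb⟩, rfl⟩
    exact ⟨p.swap, ⟨mem_cameraCenters_swap.2 hp, hb⟩, rfl⟩

theorem HasMultidegree.swap {n i j m : ℕ} {x y : Fin n → P2}
    (h : HasMultidegree (cameraCenters x y) i j m) : HasMultidegree (cameraCenters y x) j i m := by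
  obtain ⟨G, hG, h⟩ := h
  refine ⟨rename Sum.swap G, ?_, fun u v huv => ?_⟩
  · rwa [Ne, map_eq_zero_iff _ (rename_injective _ Sum.swap_leftInverse.injective)]
  · rw [eval_rename] at huv
    have hcomp : Sum.elim (fun t : Fin j × Fin 3 => u t.1 t.2) (fun t => v t.1 t.2) ∘ Sum.swap =
        Sum.elim (fun t : Fin i × Fin 3 => v t.1 t.2) (fun t => u t.1 t.2) := by
      funext t
      rcases t with t | t <;> rfl
    rw [hcomp] at huv
    rw [← h v u huv, ← Prod.swap_injective.encard_image]
    congr 1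
    ext p
    rw [Set.image_swap_eq_preimage_swap]
    simp only [slice, Set.mem_preimage, Set.mem_ofPred_eq, mem_cameraCenters_swap, Prod.fst_swap,
      Prod.snd_swap]
    tauto

end CameraCenters

theorem mainTheorem8 (x y : Fin 4 → CameraCenters.P2)
    (hx : CameraCenters.GeneralPosition x) (hy : CameraCenters.GeneralPosition y) :
    CameraCenters.IsHypersurface (CameraCenters.cameraCenters x y) ∧
    (CameraCenters.StandardPosition x → CameraCenters.StandardPosition y →
      CameraCenters.IsEquationOf CameraCenters.standardEquation
        (CameraCenters.cameraCenters x y)) ∧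
    (Prod.fst '' CameraCenters.cameraCenters x y = Set.univ ∧
      Prod.snd '' CameraCenters.cameraCenters x y = Set.univ) ∧
    (CameraCenters.IsHypersurfaceOfBidegree (CameraCenters.cameraCenters x y) 2 2 ∧
      CameraCenters.HasMultidegree (CameraCenters.cameraCenters x y) 2 1 2 ∧
      CameraCenters.HasMultidegree (CameraCenters.cameraCenters x y) 1 2 2) ∧
    ((∀ a, (∀ i, a ≠ x i) →
        CameraCenters.IsConic
          (CameraCenters.fiberOverFst (CameraCenters.cameraCenters x y) a)) ∧
      (∀ a, CameraCenters.OffLines x a →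
        CameraCenters.IsNondegenerateConic
          (CameraCenters.fiberOverFst (CameraCenters.cameraCenters x y) a)) ∧
      (∀ b, (∀ i, b ≠ y i) →
        CameraCenters.IsConic
          (CameraCenters.fiberOverSnd (CameraCenters.cameraCenters x y) b)) ∧
      (∀ b, CameraCenters.OffLines y b →
        CameraCenters.IsNondegenerateConic
          (CameraCenters.fiberOverSnd (CameraCenters.cameraCenters x y) b))) := by
  obtain ⟨M, hM⟩ := hx.exists_isNormalizing
  obtain ⟨N, hN⟩ := hy.exists_isNormalizing
  have hE := CameraCenters.isHypersurfaceOfBidegree_cameraCenters hM hN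
  refine ⟨⟨2, 2, by simp, hE⟩, fun hxs hys => ?_,
    ⟨CameraCenters.image_fst_cameraCenters hM hN, ?_⟩,
    ⟨hE, CameraCenters.hasMultidegree_cameraCenters hM hN,
      (CameraCenters.hasMultidegree_cameraCenters hN hM).swap⟩,
    fun a ha => CameraCenters.isConic_fiberOverFst hM hN ha,
    fun a ha => CameraCenters.isNondegenerateConic_fiberOverFst hM hN ha,
    fun b hb => ?_, fun b hb => ?_⟩
  · have h := CameraCenters.isEquationOf_linSubst (by simp) (by simp)
      (CameraCenters.mem_cameraCenters_iff_tripleForm hxs.isNormalizing_one hys.isNormalizing_one)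
    rwa [CameraCenters.linSubst_one_one] at h
  · rw [CameraCenters.image_snd_cameraCenters]
    exact CameraCenters.image_fst_cameraCenters hN hM
  · rw [CameraCenters.fiberOverSnd_cameraCenters]
    exact CameraCenters.isConic_fiberOverFst hN hM hb
  · rw [CameraCenters.fiberOverSnd_cameraCenters]
    exact CameraCenters.isNondegenerateConic_fiberOverFst hN hM hb
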